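/- Let $\mathbb S^2\subset\mathbb R^3$ be the round unit sphere with its surface measure and Laplace–Beltrami operator $\Delta_g$. For $n\ge 0$ let $\pi_n$ be the $L^2(\mathbb S^2)$-orthogonal projection onto the eigenspace of $-\Delta_g$ with eigenvalue $n(n+1)$, and for smooth $\phi:\mathbb S^2\to\mathbb C$ put $$e^{it\Delta_g}\phi=\sum_{n\ge0}e^{-itn(n+1)}\pi_n\phi,\qquad \|\phi\|_{H^s(\mathbb S^2)}=\Big(\sum_{n\ge0}(1+n(n+1))^{s}\,\|\pi_n\phi\|_{L^2(\mathbb S^2)}^2\Big)^{1/2}\quad(s\in\mathbb R).$$ **Theorem.** Let $2\le p\le\infty$ and $s<\frac12-\frac1{2p}$ (with $\frac1{2p}=0$ for $p=\infty$). Then the maximal estimate $$\Big\|\sup_{t\in[0,2\pi]}\big|e^{it\Delta_g}\phi\big|\Big\|_{L^p(\mathbb S^2)}\lesssim\|\phi\|_{H^s(\mathbb S^2)}$$ fails, even for smooth data: there is no finite constant $C$ such that $$\Big\|\sup_{t\in[0,2\pi]}\big|e^{it\Delta_g}\phi\big|\Big\|_{L^p(\mathbb S^2)}\le C\,\|\phi\|_{H^s(\mathbb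 S^2)}\qquad\text{for all }\phi\in C^\infty(\mathbb S^2;\mathbb C).$$ -/

import Mathlib

open MeasureTheory
open scoped Manifold ContDiff ENNReal

noncomputable section

/-- The Euclidean space `ℝ³`. -/
abbrev E3 : Type := EuclideanSpace ℝ (Fin 3)

/-- The unit sphere `𝕊² ⊂ ℝ³`. -/
abbrev S2 : Type := Metric.sphere (0 : E3) 1

/-- The surface measure on `𝕊²` (total mass `4π`). -/
def surfaceMeasure : Measure S2 := (volume : Measure E3).toSphere

/-- Smooth (`C^∞`) complex-valued functions on `𝕊²`. -/
def IsSmooth (f : S2 → ℂ) : Prop := ContMDiff (𝓡 2) 𝓘(ℝ, ℂ) ∞ f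

/-- The extension `y ↦ f (y / |y|)` of a function on `𝕊²`, homogeneous of degree zero on
`ℝ³ \ {0}` (with the irrelevant value `0` at the origin). -/
def radialExtension (f : S2 → ℂ) (y : E3) : ℂ :=
  if h : y ≠ 0 then
    f ⟨‖y‖⁻¹ • y, by
      rw [mem_sphere_zero_iff_norm, norm_smul, norm_inv, norm_norm,
        inv_mul_cancel₀ (norm_ne_zero_iff.mpr h)]⟩
  else 0

/-- The Laplace-Beltrami operator `Δ_g` of the round sphere: since
`Δ_{ℝ³} = ∂_r² + (2/r) ∂_r + r⁻² Δ_g`, it is the restriction to `𝕊²` of the Euclidean Laplacian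
of the extension that is constant along rays. -/
def laplaceBeltrami (f : S2 → ℂ) (x : S2) : ℂ :=
  Laplacian.laplacian (radialExtension f) (x : E3)

/-- `f` lies in the eigenspace `E_n` of spherical harmonics of degree `n`, that is,
`-Δ_g f = n (n + 1) f` with `f` smooth. -/
def IsSphericalHarmonic (n : ℕ) (f : S2 → ℂ) : Prop :=
  IsSmooth f ∧ ∀ x, -laplaceBeltrami f x = ((n : ℂ) * ((n : ℂ) + 1)) * f x

/-- `f` is the orthogonal projection of `φ` to `E_n` in `L²(𝕊²)`. -/
def IsSpectralComponent (n : ℕ) (φ f : S2 → ℂ) : Prop :=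
  IsSphericalHarmonic n f ∧
    ∀ g, IsSphericalHarmonic n g →
      ∫ x, starRingEnd ℂ (g x) * (φ x - f x) ∂surfaceMeasure = 0

open Classical in
/-- The spectral projection `π_n φ`. As `E_n` is finite-dimensional and consists of continuous
functions, for every smooth `φ` there is exactly one function as described, so the second
alternative does not occur. -/
def spectralProj (n : ℕ) (φ : S2 → ℂ) : S2 → ℂ :=
  if h : ∃ f, IsSpectralComponent n φ f then h.choose else 0

/-- The Schrödinger flow `e^{itΔ_g} φ = ∑_n e^{-itn(n+1)} π_n φ`. For smooth `φ` this series
converges absolutely and uniformly on `𝕊²`. -/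
def schrodingerFlow (t : ℝ) (φ : S2 → ℂ) (x : S2) : ℂ :=
  ∑' n : ℕ, Complex.exp (-Complex.I * (t : ℂ) * ((n : ℂ) * ((n : ℂ) + 1))) * spectralProj n φ x

/-- The maximal function `sup_{t ∈ [0, 2π]} |e^{itΔ_g} φ (x)|`. -/
def maximalFunction (φ : S2 → ℂ) (x : S2) : ℝ≥0∞ :=
  ⨆ t ∈ Set.Icc (0 : ℝ) (2 * Real.pi), ‖schrodingerFlow t φ x‖ₑ

/-- The Sobolev norm `‖φ‖_{H^s} = ‖(1 - Δ_g)^{s/2} φ‖_{L²}`, that is,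
`(∑_n (1 + n (n + 1))^s ‖π_n φ‖_{L²}²)^{1/2}`. It is finite for smooth `φ`. -/
def sobolevNorm (s : ℝ) (φ : S2 → ℂ) : ℝ≥0∞ :=
  (∑' n : ℕ, ENNReal.ofReal ((1 + (n : ℝ) * ((n : ℝ) + 1)) ^ s) *
    eLpNorm (spectralProj n φ) 2 surfaceMeasure ^ 2) ^ (1 / 2 : ℝ)

end

/-!
The counterexample is a wave packet travelling along the equator. Let
`h_k = (x₁ + i x₂)^k` and let `φ` be the sum of the `h_k` with `N ≤ k < N + M`, where `N = 3 M²`.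
In longitude `θ` the flow multiplies `|x₁ + i x₂|^k` by `exp (i (k θ - t k (k + 1)))`. With
`k = N + m` and `t = θ / (2 N + 1)` the terms linear in `m` cancel, and up to a common factor of
modulus one only `exp (-i t m²)` is left, whose phase is at most `π / 3` because `M² ≲ N`. Hence at
every point the maximal function is at least `M |x₁ + i x₂|^(N + M) / 2`
(`le_maximalFunction_packet`).

On the strip `|x₃| ≤ 1 / (2 M)`, of measure comparable to `1 / M`, the factor
`|x₁ + i x₂|^(N + M)` is at least `1 / 2`, so the `L^p` norm of the maximal function is at least
a constant times `M^(1 - 1/p)` (`le_eLpNorm_maximalFunction_packet`). Each `h_k` has squared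
`L²` norm `O (k^(-1/2)) = O (1 / M)`, so for `r ≥ max s 0` the `H^s` norm of `φ` is
`O (M^(2 r))` (`sobolevNorm_packet_le`). As `2 r < 1 - 1/p` for `r = max s 0`, letting `M → ∞`
excludes a finite constant.

To identify the spectral components of `φ` one needs that the `h_k` are spherical harmonics
(`isSphericalHarmonic_beam`, a computation of second derivatives of the radial extension) and that
spherical harmonics of different degrees are orthogonal
(`IsSphericalHarmonic.integral_mul_eq_zero`). The latter follows from Green's identity on `ℝ³` for
the radial extensions `F`, `H`, multiplied by a radial cutoff `χ`: the divergence of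
`χ (H ∇F - F ∇H)` integrates to zero, and its part containing `∇χ` vanishes because `F` and `H`
have no radial derivative. Polar coordinates then turn the identity into one on the sphere.
-/

/-! ### Radial extensions and the Laplacian -/

lemma radialExtension_of_ne (f : S2 → ℂ) {y : E3} (hy : y ≠ 0)
    (h : ‖y‖⁻¹ • y ∈ Metric.sphere (0 : E3) 1) :
    radialExtension f y = f ⟨‖y‖⁻¹ • y, h⟩ := by
  simp [radialExtension, hy]

lemma radialExtension_smul (f : S2 → ℂ) {c : ℝ} (hc : 0 < c) (y : E3) :
    radialExtension f (c • y) = radialExtension f y := by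
  by_cases hy : y = 0
  · simp [hy]
  · have hcy : c • y ≠ 0 := smul_ne_zero hc.ne' hy
    have h1 : ‖c • y‖⁻¹ • (c • y) = ‖y‖⁻¹ • y := by
      rw [norm_smul, Real.norm_of_nonneg hc.le, smul_smul, mul_inv]
      congr 1
      field_simp
    have hm : ‖y‖⁻¹ • y ∈ Metric.sphere (0 : E3) 1 := by
      rw [mem_sphere_zero_iff_norm, norm_smul, norm_inv, norm_norm,
        inv_mul_cancel₀ (norm_ne_zero_iff.mpr hy)]
    rw [radialExtension_of_ne f hcy (h1 ▸ hm), radialExtension_of_ne f hy hm]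
    simp only [h1]

lemma IsSmooth.contDiffAt_radialExtension {f : S2 → ℂ} (hf : IsSmooth f) {y : E3} (hy : y ≠ 0) :
    ContDiffAt ℝ ∞ (radialExtension f) y := by
  have : Fact (Module.finrank ℝ E3 = 2 + 1) := ⟨finrank_euclideanSpace_fin⟩
  let U : TopologicalSpace.Opens E3 := ⟨{0}ᶜ, isOpen_compl_singleton⟩
  let g : U → E3 := fun z => ‖(z : E3)‖⁻¹ • (z : E3)
  have hg' : ∀ z, g z ∈ Metric.sphere (0 : E3) 1 := by
    intro z
    rw [mem_sphere_zero_iff_norm, norm_smul, norm_inv, norm_norm,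
      inv_mul_cancel₀ (norm_ne_zero_iff.mpr z.2)]
  have hg : ContMDiff 𝓘(ℝ, E3) 𝓘(ℝ, E3) ∞ g := by
    intro z
    refine (contMDiffAt_subtype_iff (f := fun w : E3 => ‖w‖⁻¹ • w)).2 ?_
    rw [contMDiffAt_iff_contDiffAt]
    exact ((contDiffAt_norm ℝ z.2).inv (norm_ne_zero_iff.mpr z.2)).smul contDiffAt_id
  have hgs : ContMDiff 𝓘(ℝ, E3) (𝓡 2) ∞ (Set.codRestrict g _ hg' : U → S2) :=
    hg.codRestrict_sphere hg'
  have hfg : ContMDiff 𝓘(ℝ, E3) 𝓘(ℝ, ℂ) ∞ (f ∘ (Set.codRestrict g _ hg' : U → S2)) :=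
    ContMDiff.comp hf hgs
  have h2 := hfg ⟨y, hy⟩
  rw [← contMDiffAt_iff_contDiffAt]
  refine (contMDiffAt_subtype_iff (U := U) (x := ⟨y, hy⟩)).1 ?_
  convert h2 using 1
  funext z
  exact radialExtension_of_ne f z.2 (hg' z)

/-- Radial extensions have vanishing radial derivative. -/
lemma fderiv_radialExtension_self {f : S2 → ℂ} (hf : IsSmooth f) {y : E3} (hy : y ≠ 0) :
    fderiv ℝ (radialExtension f) y y = 0 := by
  have h1 : HasFDerivAt (radialExtension f) (fderiv ℝ (radialExtension f) y) ((1 : ℝ) • y) := by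
    rw [one_smul]
    exact ((hf.contDiffAt_radialExtension hy).differentiableAt (by simp)).hasFDerivAt
  have h2 : HasDerivAt (fun t : ℝ => t • y) y 1 := by
    simpa using (hasDerivAt_id (1 : ℝ)).smul_const y
  have h3 := h1.comp_hasDerivAt (1 : ℝ) h2
  have h4 : HasDerivAt (radialExtension f ∘ fun t : ℝ => t • y) 0 1 := by
    refine (hasDerivAt_const (1 : ℝ) (radialExtension f y)).congr_of_eventuallyEq ?_
    filter_upwards [lt_mem_nhds (zero_lt_one' ℝ)] with t ht
    exact radialExtension_smul f ht y
  exact h3.unique h4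

/-- The Laplacian of a radial extension is homogeneous of degree `-2`. -/
lemma laplacian_radialExtension_smul (f : S2 → ℂ) {c : ℝ} (hc : 0 < c) (y : E3) :
    Laplacian.laplacian (radialExtension f) y
      = (c : ℂ) ^ 2 * Laplacian.laplacian (radialExtension f) (c • y) := by
  have hF : (fun z => radialExtension f (c • z)) = radialExtension f :=
    funext fun z => radialExtension_smul f hc z
  have h1 : fderiv ℝ (radialExtension f) = fun z => c • fderiv ℝ (radialExtension f) (c • z) := by
    funext z
    conv_lhs => rw [← hF]
    exact fderiv_comp_smul c
  have h2 : ∀ z, fderiv ℝ (fderiv ℝ (radialExtension f)) z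
      = c • c • fderiv ℝ (fderiv ℝ (radialExtension f)) (c • z) := by
    intro z
    conv_lhs => rw [h1]
    let _ := invertibleOfNonzero hc.ne'
    change fderiv ℝ (c • fun w => fderiv ℝ (radialExtension f) (c • w)) z = _
    refine (fderiv_const_smul_of_invertible (R := ℝ) (F := E3 →L[ℝ] ℂ) c).trans ?_
    rw [fderiv_comp_smul]
  rw [InnerProductSpace.laplacian_eq_iteratedFDeriv_stdOrthonormalBasis]
  simp only [iteratedFDeriv_two_apply, Finset.mul_sum]
  refine Finset.sum_congr rfl fun i _ => ?_
  rw [h2 y]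
  simp
  ring

lemma laplacian_radialExtension_eq (f : S2 → ℂ) {y : E3} (hy : y ≠ 0) :
    Laplacian.laplacian (radialExtension f) y
      = ((‖y‖ : ℂ) ^ 2)⁻¹ * radialExtension (laplaceBeltrami f) y := by
  have hm : ‖y‖⁻¹ • y ∈ Metric.sphere (0 : E3) 1 := by
    rw [mem_sphere_zero_iff_norm, norm_smul, norm_inv, norm_norm,
      inv_mul_cancel₀ (norm_ne_zero_iff.mpr hy)]
  rw [laplacian_radialExtension_smul f (inv_pos.2 (norm_pos_iff.2 hy)),
    radialExtension_of_ne _ hy hm]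
  simp [laplaceBeltrami]

lemma IsSmooth.continuous {f : S2 → ℂ} (hf : IsSmooth f) : Continuous f := ContMDiff.continuous hf

lemma IsSmooth.contDiffAt_fderiv_radialExtension {f : S2 → ℂ} (hf : IsSmooth f) {y : E3}
    (hy : y ≠ 0) : ContDiffAt ℝ 1 (fderiv ℝ (radialExtension f)) y :=
  (contDiffAt_infty.1 (hf.contDiffAt_radialExtension hy) 2).fderiv_right
    (m := 1) one_add_one_eq_two.le

/-! ### Green's identity on the sphere -/

/-- Integration in polar coordinates of a product of a radial and an angular function. No
integrability is assumed, since both sides use the same convention for non-integrable functions. -/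
lemma integral_radial_mul_radialExtension (k : ℝ → ℂ) (f : S2 → ℂ) :
    ∫ y : E3, k ‖y‖ * radialExtension f y
      = (∫ x, f x ∂surfaceMeasure) *
        ∫ r : Set.Ioi (0 : ℝ), k r ∂Measure.volumeIoiPow (Module.finrank ℝ E3 - 1) := by
  calc ∫ y : E3, k ‖y‖ * radialExtension f y
      = ∫ y : ({(0 : E3)}ᶜ : Set E3), k ‖y.1‖ * radialExtension f y.1
          ∂((volume : Measure E3).comap (↑)) := by
        rw [integral_subtype_comap (measurableSet_singleton _).compl
          fun y : E3 => k ‖y‖ * radialExtension f y, restrict_compl_singleton]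
    _ = ∫ z : S2 × Set.Ioi (0 : ℝ), f z.1 * k z.2
          ∂((volume : Measure E3).toSphere.prod
            (Measure.volumeIoiPow (Module.finrank ℝ E3 - 1))) := by
        rw [← (Measure.measurePreserving_homeomorphUnitSphereProd
          (volume : Measure E3)).integral_comp (Homeomorph.measurableEmbedding _)]
        congr 1
        funext y
        have hm : ‖(y : E3)‖⁻¹ • (y : E3) ∈ Metric.sphere (0 : E3) 1 := by
          rw [mem_sphere_zero_iff_norm, norm_smul, norm_inv, norm_norm,
            inv_mul_cancel₀ (norm_ne_zero_iff.mpr y.2)]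
        have h1 : ((homeomorphUnitSphereProd E3) y).1 = ⟨‖(y : E3)‖⁻¹ • (y : E3), hm⟩ := by
          ext1
          simp
        rw [radialExtension_of_ne f y.2 hm, mul_comm, h1, homeomorphUnitSphereProd_apply_snd_coe]
    _ = _ := by
        rw [integral_prod_mul (fun x : S2 => f x) (fun r : Set.Ioi (0 : ℝ) => k r)]
        rfl

lemma integral_fderiv_eq_zero_of_hasCompactSupport {G : E3 → ℂ} (hG : ContDiff ℝ 1 G)
    (hc : HasCompactSupport G) (v : E3) : ∫ y, fderiv ℝ G y v = 0 := by
  -- Integration by parts against the constant `1`, which need not be integrable.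
  have h := integral_mul_fderiv_eq_neg_fderiv_mul_of_integrable (μ := (volume : Measure E3))
    (f := fun _ : E3 => (1 : ℂ)) (g := G) (v := v) (by simp)
    (by
      simp only [one_mul]
      exact ((hG.continuous_fderiv one_ne_zero).clm_apply
        continuous_const).integrable_of_hasCompactSupport (hc.fderiv_apply ℝ v))
    (by
      simp only [one_mul]
      exact hG.continuous.integrable_of_hasCompactSupport hc)
    (fun x _ => differentiableAt_const _)
    (fun x _ => (hG.differentiable one_ne_zero) x)
  simpa using h

/-- A smooth bump function on `ℝ` supported in `[1, 3]`, to be evaluated at `‖y‖²`. -/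
noncomputable def annulusBump : ContDiffBump (2 : ℝ) := ⟨1 / 2, 1, by norm_num, by norm_num⟩

/-- A smooth radial cutoff on `ℝ³` supported in the annulus `1 ≤ ‖y‖² ≤ 3`. As a function of `‖y‖²`
it is smooth everywhere, and it vanishes near the origin, where radial extensions are singular. -/
noncomputable def annulusCutoff (y : E3) : ℂ := (annulusBump (‖y‖ ^ 2) : ℝ)

lemma contDiff_annulusCutoff : ContDiff ℝ ∞ annulusCutoff :=
  Complex.ofRealCLM.contDiff.comp (annulusBump.contDiff.comp (contDiff_norm_sq ℝ))

lemma annulusCutoff_eq_zero {y : E3} (hy : ‖y‖ < 1) : annulusCutoff y = 0 := by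
  have : annulusBump (‖y‖ ^ 2) = 0 := by
    apply annulusBump.zero_of_le_dist
    rw [Real.dist_eq, abs_sub_comm]
    refine le_trans ?_ (le_abs_self _)
    have : annulusBump.rOut = 1 := rfl
    nlinarith [norm_nonneg y]
  simp [annulusCutoff, this]

lemma hasCompactSupport_annulusCutoff : HasCompactSupport annulusCutoff := by
  refine HasCompactSupport.intro (isCompact_closedBall (0 : E3) 2) fun y hy => ?_
  have hy' : 2 < ‖y‖ := by simpa using hy
  have : annulusBump (‖y‖ ^ 2) = 0 := by
    apply annulusBump.zero_of_le_dist
    rw [Real.dist_eq]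
    refine le_trans ?_ (le_abs_self _)
    have : annulusBump.rOut = 1 := rfl
    nlinarith
  simp [annulusCutoff, this]

lemma fderiv_annulusCutoff (y v : E3) :
    fderiv ℝ annulusCutoff y v
      = ((deriv annulusBump (‖y‖ ^ 2) * 2 : ℝ) : ℂ) * (inner ℝ y v : ℝ) := by
  have h1 : HasFDerivAt (fun y : E3 => ‖y‖ ^ 2) (2 • (innerSL ℝ y)) y :=
    (hasStrictFDerivAt_norm_sq y).hasFDerivAt
  have h2 : HasDerivAt (annulusBump : ℝ → ℝ) (deriv annulusBump (‖y‖ ^ 2)) (‖y‖ ^ 2) :=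
    ((annulusBump.contDiff (n := 1)).differentiable one_ne_zero _).hasDerivAt
  have h3 := (Complex.ofRealCLM.hasFDerivAt).comp y (h2.comp_hasFDerivAt y h1)
  have h4 : HasFDerivAt annulusCutoff _ y := h3
  rw [h4.fderiv]
  simp
  ring

/-- The component in the direction `v` of the vector field `χ (H ∇F - F ∇H)`, where `F` and `H` are
the radial extensions of `f` and `h` and `χ` is the cutoff. Its divergence gives Green's
identity. -/
noncomputable def greenField (f h : S2 → ℂ) (v y : E3) : ℂ :=
  annulusCutoff y * (radialExtension h y * fderiv ℝ (radialExtension f) y v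
    - radialExtension f y * fderiv ℝ (radialExtension h) y v)

lemma greenField_eventuallyEq_zero (f h : S2 → ℂ) (v : E3) :
    greenField f h v =ᶠ[nhds 0] fun _ => 0 := by
  filter_upwards [Metric.ball_mem_nhds (0 : E3) one_pos] with y hy
  rw [greenField, annulusCutoff_eq_zero (by simpa using hy), zero_mul]

lemma contDiff_greenField {f h : S2 → ℂ} (hf : IsSmooth f) (hh : IsSmooth h) (v : E3) :
    ContDiff ℝ 1 (greenField f h v) := by
  rw [contDiff_iff_contDiffAt]
  intro y
  by_cases hy : y = 0
  · subst hy
    exact contDiffAt_const.congr_of_eventuallyEq (greenField_eventuallyEq_zero f h v)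
  · have hF := hf.contDiffAt_radialExtension hy
    have hH := hh.contDiffAt_radialExtension hy
    have hF' : ContDiffAt ℝ 1 (fun z => fderiv ℝ (radialExtension f) z v) y :=
      (hf.contDiffAt_fderiv_radialExtension hy).clm_apply contDiffAt_const
    have hH' : ContDiffAt ℝ 1 (fun z => fderiv ℝ (radialExtension h) z v) y :=
      (hh.contDiffAt_fderiv_radialExtension hy).clm_apply contDiffAt_const
    exact (contDiff_annulusCutoff.contDiffAt.of_le (by simp)).mul
      (((hH.of_le (by simp)).mul hF').sub ((hF.of_le (by simp)).mul hH'))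

lemma hasCompactSupport_greenField (f h : S2 → ℂ) (v : E3) :
    HasCompactSupport (greenField f h v) :=
  hasCompactSupport_annulusCutoff.mul_right

lemma fderiv_greenField {f h : S2 → ℂ} (hf : IsSmooth f) (hh : IsSmooth h) (v : E3) {y : E3}
    (hy : y ≠ 0) :
    fderiv ℝ (greenField f h v) y v
      = fderiv ℝ annulusCutoff y v * (radialExtension h y * fderiv ℝ (radialExtension f) y v
          - radialExtension f y * fderiv ℝ (radialExtension h) y v)
        + annulusCutoff y *
          (radialExtension h y * fderiv ℝ (fderiv ℝ (radialExtension f)) y v v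
          - radialExtension f y * fderiv ℝ (fderiv ℝ (radialExtension h)) y v v) := by
  have key : ∀ {f : S2 → ℂ}, IsSmooth f →
      HasFDerivAt (fun z => fderiv ℝ (radialExtension f) z v)
        ((fderiv ℝ (fderiv ℝ (radialExtension f)) y).flip v) y := by
    intro f hf
    have h1 := ((hf.contDiffAt_fderiv_radialExtension hy).differentiableAt one_ne_zero).hasFDerivAt
    simpa using h1.clm_apply (hasFDerivAt_const v y)
  have hF := ((hf.contDiffAt_radialExtension hy).differentiableAt (by simp)).hasFDerivAt
  have hH := ((hh.contDiffAt_radialExtension hy).differentiableAt (by simp)).hasFDerivAt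
  have hA := ((contDiff_annulusCutoff.differentiable (by simp)) y).hasFDerivAt
  have hG : HasFDerivAt (greenField f h v) _ y := hA.mul ((hH.mul (key hf)).sub (hF.mul (key hh)))
  rw [hG.fderiv]
  simp
  ring

/-- Green's identity, smeared over the radial variable. -/
lemma integral_annulusCutoff_mul_laplacian_sub {f h : S2 → ℂ} (hf : IsSmooth f)
    (hh : IsSmooth h) :
    ∫ y : E3, annulusCutoff y *
      (radialExtension h y * Laplacian.laplacian (radialExtension f) y
        - radialExtension f y * Laplacian.laplacian (radialExtension h) y) = 0 := by
  set e := stdOrthonormalBasis ℝ E3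
  have hsum : ∀ y : E3, annulusCutoff y *
      (radialExtension h y * Laplacian.laplacian (radialExtension f) y
        - radialExtension f y * Laplacian.laplacian (radialExtension h) y)
      = ∑ i, fderiv ℝ (greenField f h (e i)) y (e i) := by
    intro y
    by_cases hy : y = 0
    · subst hy
      simp [annulusCutoff_eq_zero, (greenField_eventuallyEq_zero f h _).fderiv_eq]
    · -- The gradient of the cutoff is radial, and radial extensions have no radial derivative.
      have hrad : ∀ {f : S2 → ℂ}, IsSmooth f →
          ∑ i, ((inner ℝ y (e i) : ℝ) : ℂ) * fderiv ℝ (radialExtension f) y (e i) = 0 := by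
        intro f hf
        rw [← fderiv_radialExtension_self hf hy]
        conv_rhs => rw [show fderiv ℝ (radialExtension f) y y
          = fderiv ℝ (radialExtension f) y (∑ i, inner ℝ (e i) y • e i) by
            rw [e.sum_repr' y], map_sum]
        simp [real_inner_comm]
      simp only [fderiv_greenField hf hh _ hy, fderiv_annulusCutoff]
      rw [InnerProductSpace.laplacian_eq_iteratedFDeriv_stdOrthonormalBasis,
        InnerProductSpace.laplacian_eq_iteratedFDeriv_stdOrthonormalBasis]
      simp only [iteratedFDeriv_two_apply, Matrix.cons_val_zero, Matrix.cons_val_one,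
        Matrix.cons_val_fin_one]
      rw [Finset.sum_add_distrib, ← Finset.mul_sum, Finset.sum_sub_distrib, ← Finset.mul_sum,
        ← Finset.mul_sum, right_eq_add]
      calc _ = ((deriv annulusBump (‖y‖ ^ 2) * 2 : ℝ) : ℂ) *
            (radialExtension h y *
              ∑ i, ((inner ℝ y (e i) : ℝ) : ℂ) * fderiv ℝ (radialExtension f) y (e i)
            - radialExtension f y *
              ∑ i, ((inner ℝ y (e i) : ℝ) : ℂ) * fderiv ℝ (radialExtension h) y (e i)) := by
            rw [Finset.mul_sum, Finset.mul_sum, ← Finset.sum_sub_distrib, Finset.mul_sum]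
            refine Finset.sum_congr rfl fun i _ => ?_
            ring
        _ = 0 := by rw [hrad hf, hrad hh]; simp
  simp only [hsum]
  rw [integral_finsetSum]
  · exact Finset.sum_eq_zero fun i _ => integral_fderiv_eq_zero_of_hasCompactSupport
      (contDiff_greenField hf hh _) (hasCompactSupport_greenField f h _) _
  · intro i _
    exact (((contDiff_greenField hf hh _).continuous_fderiv one_ne_zero).clm_apply
      continuous_const).integrable_of_hasCompactSupport
        ((hasCompactSupport_greenField f h _).fderiv_apply ℝ _)

lemma radialExtension_mul (f h : S2 → ℂ) (y : E3) :
    radialExtension (fun x => f x * h x) y = radialExtension f y * radialExtension h y := by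
  by_cases hy : y = 0 <;> simp [radialExtension, hy]

lemma radialExtension_const_mul (c : ℂ) (f : S2 → ℂ) (y : E3) :
    radialExtension (fun x => c * f x) y = c * radialExtension f y := by
  by_cases hy : y = 0 <;> simp [radialExtension, hy]

/-- The radial weight `χ(r) r⁻²` produced by Green's identity has nonzero integral. By polar
coordinates this integral is a nonzero multiple of the integral over `ℝ³` of a nonnegative
continuous function. -/
lemma integral_radial_weight_ne_zero :
    ∫ r : Set.Ioi (0 : ℝ), ((annulusBump ((r : ℝ) ^ 2) : ℝ) : ℂ) * (((r : ℝ) : ℂ) ^ 2)⁻¹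
      ∂Measure.volumeIoiPow (Module.finrank ℝ E3 - 1) ≠ 0 := by
  intro h0
  have h1 := integral_radial_mul_radialExtension
    (fun r => ((annulusBump (r ^ 2) : ℝ) : ℂ) * ((r : ℂ) ^ 2)⁻¹) (fun _ => 1)
  rw [h0, mul_zero] at h1
  set w : E3 → ℝ := fun y => annulusBump (‖y‖ ^ 2) * (‖y‖ ^ 2)⁻¹ with hw
  have h2 : ∫ y : E3, w y = 0 := by
    have : ∫ y : E3, ((w y : ℝ) : ℂ) = 0 := by
      rw [← h1]
      congr 1
      funext y
      by_cases hy : y = 0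
      · simp [hy, hw, radialExtension]
      · simp [hy, hw, radialExtension]
    rwa [integral_complex_ofReal, Complex.ofReal_eq_zero] at this
  have hcont : Continuous w := by
    rw [continuous_iff_continuousAt]
    intro y
    by_cases hy : y = 0
    · subst hy
      refine (continuousAt_const (y := (0 : ℝ))).congr ?_
      filter_upwards [Metric.ball_mem_nhds (0 : E3) one_pos] with y hy
      have := annulusCutoff_eq_zero (y := y) (by simpa using hy)
      simp only [annulusCutoff, Complex.ofReal_eq_zero] at this
      simp [hw, this]
    · exact ((annulusBump.continuous.comp (continuous_norm.pow 2)).continuousAt).mul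
        ((continuous_norm.pow 2).continuousAt.inv₀ (by simpa using hy))
  have hcs : HasCompactSupport w := by
    refine HasCompactSupport.mul_right (f := fun y : E3 => annulusBump (‖y‖ ^ 2)) ?_
    have := hasCompactSupport_annulusCutoff.comp_left (g := Complex.re) (by simp)
    exact this
  have hpos : 0 < ∫ y : E3, w y := by
    refine hcont.integral_pos_of_hasCompactSupport_nonneg_nonzero hcs
      (fun y => mul_nonneg annulusBump.nonneg (by positivity))
      (x := Real.sqrt 2 • EuclideanSpace.single 0 (1 : ℝ)) ?_
    have h3 : ‖(Real.sqrt 2 • EuclideanSpace.single 0 (1 : ℝ) : E3)‖ ^ 2 = 2 := by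
      simp [norm_smul]
    simp only [hw, h3]
    rw [annulusBump.one_of_mem_closedBall (Metric.mem_closedBall_self annulusBump.rIn_pos.le)]
    norm_num
  exact hpos.ne' h2

/-- Spherical harmonics of different degrees are orthogonal with respect to the bilinear
pairing. -/
lemma IsSphericalHarmonic.integral_mul_eq_zero {n m : ℕ} (hnm : n ≠ m) {f h : S2 → ℂ}
    (hf : IsSphericalHarmonic n f) (hh : IsSphericalHarmonic m h) :
    ∫ x, f x * h x ∂surfaceMeasure = 0 := by
  have hLap : ∀ {n : ℕ} {f : S2 → ℂ}, IsSphericalHarmonic n f → ∀ {y : E3}, y ≠ 0 →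
      Laplacian.laplacian (radialExtension f) y
        = -(((‖y‖ : ℂ) ^ 2)⁻¹ * ((n : ℂ) * (n + 1)) * radialExtension f y) := by
    intro n f hf y hy
    have : laplaceBeltrami f = fun x => -((n : ℂ) * (n + 1)) * f x := by
      funext x
      linear_combination -hf.2 x
    rw [laplacian_radialExtension_eq f hy, this, radialExtension_const_mul]
    ring
  have hG := integral_annulusCutoff_mul_laplacian_sub hf.1 hh.1
  have hP := integral_radial_mul_radialExtension
    (fun r => ((annulusBump (r ^ 2) : ℝ) : ℂ) * ((r : ℂ) ^ 2)⁻¹) (fun x => f x * h x)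
  have hEq : ∀ y : E3, annulusCutoff y *
      (radialExtension h y * Laplacian.laplacian (radialExtension f) y
        - radialExtension f y * Laplacian.laplacian (radialExtension h) y)
      = ((m : ℂ) * (m + 1) - (n : ℂ) * (n + 1)) *
        ((((annulusBump (‖y‖ ^ 2) : ℝ) : ℂ) * ((‖y‖ : ℂ) ^ 2)⁻¹) *
          radialExtension (fun x => f x * h x) y) := by
    intro y
    by_cases hy : y = 0
    · subst hy
      simp [annulusCutoff_eq_zero, radialExtension]
    · rw [hLap hf hy, hLap hh hy, radialExtension_mul, annulusCutoff]
      ring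
  simp only [hEq] at hG
  rw [integral_const_mul, hP] at hG
  have hne : ((m : ℂ) * (m + 1) - (n : ℂ) * (n + 1)) ≠ 0 := by
    rw [sub_ne_zero]
    norm_cast
    intro h
    rcases lt_or_gt_of_ne hnm with hl | hl <;> nlinarith
  exact ((mul_eq_zero.1 ((mul_eq_zero.1 hG).resolve_left hne)).resolve_right
    integral_radial_weight_ne_zero)

/-! ### Highest weight spherical harmonics -/

/-- The complex coordinate `x₁ + i x₂` on `ℝ³`. -/
noncomputable def complexCoord (y : E3) : ℂ := (y 0 : ℂ) + Complex.I * (y 1 : ℂ)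

/-- The highest weight spherical harmonic `(x₁ + i x₂)ⁿ`, a Gaussian beam concentrated near the
equator `x₃ = 0`. It is not normalized. -/
noncomputable def beam (n : ℕ) (x : S2) : ℂ := complexCoord (x : E3) ^ n

lemma contDiff_complexCoord : ContDiff ℝ ∞ complexCoord := by
  have h : ∀ i : Fin 3, ContDiff ℝ ∞ fun y : E3 => ((y i : ℝ) : ℂ) := fun i =>
    Complex.ofRealCLM.contDiff.comp (EuclideanSpace.proj (𝕜 := ℝ) (ι := Fin 3) i).contDiff
  exact (h 0).add (contDiff_const.mul (h 1))

lemma isSmooth_of_contDiff {F : E3 → ℂ} (hF : ContDiff ℝ ∞ F) :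
    IsSmooth fun x : S2 => F (x : E3) := by
  have : Fact (Module.finrank ℝ E3 = 2 + 1) := ⟨finrank_euclideanSpace_fin⟩
  have h : ContMDiff (𝓡 2) 𝓘(ℝ, E3) ∞ ((↑) : Metric.sphere (0 : E3) 1 → E3) := contMDiff_coe_sphere
  exact hF.contMDiff.comp h

lemma isSmooth_beam (n : ℕ) : IsSmooth (beam n) :=
  isSmooth_of_contDiff (contDiff_complexCoord.pow n)

lemma radialExtension_beam (n : ℕ) {y : E3} (hy : y ≠ 0) :
    radialExtension (beam n) y
      = complexCoord y ^ n * (((‖y‖ ^ 2) ^ (-(n : ℝ) / 2) : ℝ) : ℂ) := by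
  have hm : ‖y‖⁻¹ • y ∈ Metric.sphere (0 : E3) 1 := by
    rw [mem_sphere_zero_iff_norm, norm_smul, norm_inv, norm_norm,
      inv_mul_cancel₀ (norm_ne_zero_iff.mpr hy)]
  have h1 : (‖y‖ ^ 2) ^ (-(n : ℝ) / 2) = ‖y‖⁻¹ ^ n := by
    rw [← Real.rpow_natCast ‖y‖ 2, ← Real.rpow_mul (norm_nonneg y)]
    rw [show ((2 : ℕ) : ℝ) * (-(n : ℝ) / 2) = -(n : ℝ) by push_cast; ring,
      Real.rpow_neg (norm_nonneg y), Real.rpow_natCast, inv_pow]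
  rw [radialExtension_of_ne _ hy hm, beam, h1, Complex.ofReal_pow, ← mul_pow]
  congr 1
  simp [complexCoord]
  ring

/-- A second directional derivative can be computed along a line. -/
lemma iteratedFDeriv_two_eq_of_hasDerivAt {F : E3 → ℂ} {x v : E3} (hF : ContDiffAt ℝ 2 F x)
    {g g₁ : ℝ → ℂ} {g₂ : ℂ} (hg : ∀ᶠ t in nhds (0 : ℝ), F (x + t • v) = g t)
    (hg₁ : ∀ᶠ t in nhds (0 : ℝ), HasDerivAt g (g₁ t) t) (hg₂ : HasDerivAt g₁ g₂ 0) :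
    iteratedFDeriv ℝ 2 F x ![v, v] = g₂ := by
  have hline : ∀ t : ℝ, HasDerivAt (fun t : ℝ => x + t • v) v t := fun t => by
    simpa using ((hasDerivAt_id t).smul_const v).const_add x
  have hcont : Filter.Tendsto (fun t : ℝ => x + t • v) (nhds 0) (nhds x) := by
    simpa using (hline 0).continuousAt.tendsto
  have h1 : ∀ᶠ t in nhds (0 : ℝ), fderiv ℝ F (x + t • v) v = g₁ t := by
    have hF' : ∀ᶠ y in nhds x, ContDiffAt ℝ 2 F y := hF.eventually (by simp)
    filter_upwards [hcont.eventually hF', hg.eventually_nhds, hg₁] with t ht1 ht2 ht3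
    have h2 : HasDerivAt (F ∘ fun t : ℝ => x + t • v) (fderiv ℝ F (x + t • v) v) t :=
      ((ht1.differentiableAt two_ne_zero).hasFDerivAt).comp_hasDerivAt t (hline t)
    have h3 : HasDerivAt (F ∘ fun t : ℝ => x + t • v) (g₁ t) t := ht3.congr_of_eventuallyEq ht2
    exact h2.unique h3
  have h3 : HasDerivAt (fun t : ℝ => fderiv ℝ F (x + t • v) v) g₂ 0 :=
    hg₂.congr_of_eventuallyEq h1
  have h4 : HasFDerivAt (fderiv ℝ F) (fderiv ℝ (fderiv ℝ F) x) (x + (0 : ℝ) • v) := by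
    rw [zero_smul, add_zero]
    exact ((hF.fderiv_right (m := 1) one_add_one_eq_two.le).differentiableAt
      one_ne_zero).hasFDerivAt
  have h5 : HasDerivAt (fun t : ℝ => fderiv ℝ F (x + t • v)) (fderiv ℝ (fderiv ℝ F) x v) 0 :=
    h4.comp_hasDerivAt (0 : ℝ) (hline 0)
  have h6 : HasDerivAt (fun t : ℝ => fderiv ℝ F (x + t • v) v)
      (fderiv ℝ (fderiv ℝ F) x v v) 0 :=
    ((ContinuousLinearMap.apply ℝ ℂ v).hasFDerivAt).comp_hasDerivAt (0 : ℝ) h5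
  rw [iteratedFDeriv_two_apply]
  exact h6.unique h3

/-- The second directional derivative, at a point of the sphere, of the radial extension of
`(x₁ + i x₂)ⁿ`. -/
lemma iteratedFDeriv_two_radialExtension_beam (n : ℕ) (x : S2) {v : E3} (hv : ‖v‖ = 1) :
    iteratedFDeriv ℝ 2 (radialExtension (beam n)) x ![v, v]
      = (n : ℂ) * ((n - 1 : ℕ) : ℂ) * complexCoord x ^ (n - 1 - 1) * complexCoord v ^ 2
        - 2 * (n : ℂ) ^ 2 * complexCoord x ^ (n - 1) * complexCoord v * (inner ℝ (x : E3) v : ℝ)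
        + complexCoord x ^ n * ((n : ℂ) * (n + 2) * ((inner ℝ (x : E3) v : ℝ) : ℂ) ^ 2 - n) := by
  have hx : ‖(x : E3)‖ = 1 := norm_eq_of_mem_sphere x
  have h0 : (x : E3) ≠ 0 := by rw [← norm_ne_zero_iff, hx]; exact one_ne_zero
  set b : ℝ := inner ℝ (x : E3) v with hb
  set a : ℝ := -(n : ℝ) / 2 with ha
  set A := complexCoord x
  set B := complexCoord v
  have hu : ∀ t : ℝ, ‖(x : E3) + t • v‖ ^ 2 = 1 + 2 * b * t + t ^ 2 := by
    intro t
    rw [norm_add_sq_real, norm_smul, hx, hv, inner_smul_right]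
    simp [← hb]
    ring
  have hpos : ∀ᶠ t in nhds (0 : ℝ), 0 < 1 + 2 * b * t + t ^ 2 := by
    have : Continuous fun t : ℝ => 1 + 2 * b * t + t ^ 2 := by fun_prop
    exact this.continuousAt.eventually (lt_mem_nhds (by simp))
  have hdu : ∀ t : ℝ, HasDerivAt (fun t : ℝ => 1 + 2 * b * t + t ^ 2) (2 * b + 2 * t) t := by
    intro t
    have := (((hasDerivAt_id t).const_mul (2 * b)).const_add 1).add ((hasDerivAt_id t).pow 2)
    convert! this using 1
    simp
  have hdR : ∀ (a t : ℝ), 0 < 1 + 2 * b * t + t ^ 2 →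
      HasDerivAt (fun t : ℝ => (((1 + 2 * b * t + t ^ 2) ^ a : ℝ) : ℂ))
        ((((2 * b + 2 * t) * a * (1 + 2 * b * t + t ^ 2) ^ (a - 1) : ℝ)) : ℂ) t :=
    fun a t ht => ((hdu t).rpow_const (p := a) (Or.inl ht.ne')).ofReal_comp
  have hdP : ∀ (k : ℕ) (t : ℝ), HasDerivAt (fun t : ℝ => (A + (t : ℂ) * B) ^ k)
      ((k : ℂ) * (A + (t : ℂ) * B) ^ (k - 1) * B) t := by
    intro k t
    have h1 : HasDerivAt (fun t : ℝ => A + (t : ℂ) * B) B t := by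
      simpa using ((Complex.ofRealCLM.hasDerivAt (x := t)).mul_const B).const_add A
    exact h1.pow k
  have hdL : HasDerivAt (fun t : ℝ => ((2 * b + 2 * t : ℝ) : ℂ)) 2 0 := by
    simpa using (((hasDerivAt_id (0 : ℝ)).const_mul 2).const_add (2 * b)).ofReal_comp
  refine (iteratedFDeriv_two_eq_of_hasDerivAt
    (contDiffAt_infty.1 ((isSmooth_beam n).contDiffAt_radialExtension h0) 2)
    (g := fun t => (A + (t : ℂ) * B) ^ n * (((1 + 2 * b * t + t ^ 2) ^ a : ℝ) : ℂ))
    (g₁ := fun t => ((n : ℂ) * (A + (t : ℂ) * B) ^ (n - 1) * B)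
        * (((1 + 2 * b * t + t ^ 2) ^ a : ℝ) : ℂ)
      + (A + (t : ℂ) * B) ^ n * (((2 * b + 2 * t : ℝ) : ℂ) * a *
        (((1 + 2 * b * t + t ^ 2) ^ (a - 1) : ℝ) : ℂ))) ?_ ?_
    (((((hdP (n - 1) 0).const_mul (n : ℂ)).mul_const B).mul (hdR a 0 (by simp))).add
      ((hdP n 0).mul ((hdL.mul_const (a : ℂ)).mul (hdR (a - 1) 0 (by simp)))))).trans ?_
  · filter_upwards [hpos] with t ht
    have hne : (x : E3) + t • v ≠ 0 := by
      intro h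
      have := hu t
      rw [h] at this
      simp at this
      linarith
    rw [radialExtension_beam n hne, hu t]
    congr 2
    simp only [complexCoord, A, B]
    simp
    ring
  · filter_upwards [hpos] with t ht
    convert! (hdP n t).mul (hdR a t ht) using 3
    push_cast
    ring
  · simp [ha]
    ring

/-- `(x₁ + i x₂)ⁿ` restricted to the sphere is a spherical harmonic of degree `n`. -/
lemma isSphericalHarmonic_beam (n : ℕ) : IsSphericalHarmonic n (beam n) := by
  refine ⟨isSmooth_beam n, fun x => ?_⟩
  have hx : ‖(x : E3)‖ = 1 := norm_eq_of_mem_sphere x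
  have hsq : ((x : E3) 0 : ℂ) ^ 2 + ((x : E3) 1 : ℂ) ^ 2 + ((x : E3) 2 : ℂ) ^ 2 = 1 := by
    have h := EuclideanSpace.real_norm_sq_eq (x : E3)
    rw [hx, Fin.sum_univ_three] at h
    rw [one_pow] at h
    exact_mod_cast h.symm
  rw [laplaceBeltrami, InnerProductSpace.laplacian_eq_iteratedFDeriv_orthonormalBasis _
    (EuclideanSpace.basisFun (Fin 3) ℝ)]
  have hn : ∀ i, ‖(EuclideanSpace.basisFun (Fin 3) ℝ) i‖ = 1 :=
    (EuclideanSpace.basisFun (Fin 3) ℝ).norm_eq_one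
  simp only [iteratedFDeriv_two_radialExtension_beam n x (hn _), Fin.sum_univ_three]
  have hA : (n : ℂ) * (complexCoord (x : E3) ^ (n - 1) *
      (((x : E3) 0 : ℂ) + Complex.I * ((x : E3) 1 : ℂ))) = n * complexCoord (x : E3) ^ n := by
    rcases n with _ | n
    · simp
    · rw [pow_succ]
      rfl
  have hc0 : complexCoord (EuclideanSpace.basisFun (Fin 3) ℝ 0) = 1 := by simp [complexCoord]
  have hc1 : complexCoord (EuclideanSpace.basisFun (Fin 3) ℝ 1) = Complex.I := by
    simp [complexCoord]
  have hc2 : complexCoord (EuclideanSpace.basisFun (Fin 3) ℝ 2) = 0 := by simp [complexCoord]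
  have hi : ∀ i, (inner ℝ (x : E3) (EuclideanSpace.basisFun (Fin 3) ℝ i) : ℝ) = (x : E3) i := by
    intro i
    simp [EuclideanSpace.inner_single_right]
  rw [hc0, hc1, hc2, hi, hi, hi, beam]
  linear_combination (2 * (n : ℂ)) * hA
    - complexCoord (x : E3) ^ n * (n : ℂ) * (n + 2) * hsq
    - (n : ℂ) * ((n - 1 : ℕ) : ℂ) * complexCoord x ^ (n - 1 - 1) * Complex.I_sq

/-! ### Spectral components of sums of beams -/

instance : IsFiniteMeasure surfaceMeasure :=
  inferInstanceAs (IsFiniteMeasure (volume : Measure E3).toSphere)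

instance : surfaceMeasure.IsOpenPosMeasure :=
  inferInstanceAs ((volume : Measure E3).toSphere.IsOpenPosMeasure)

lemma integrable_surfaceMeasure {E : Type*} [NormedAddCommGroup E] {f : S2 → E}
    (hf : Continuous f) : Integrable f surfaceMeasure :=
  hf.integrable_of_hasCompactSupport (HasCompactSupport.of_compactSpace f)

lemma coe_sphere_ne_zero (x : S2) : (x : E3) ≠ 0 := by
  rw [← norm_ne_zero_iff, norm_eq_of_mem_sphere x]
  exact one_ne_zero

lemma IsSphericalHarmonic.conj {n : ℕ} {f : S2 → ℂ} (hf : IsSphericalHarmonic n f) :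
    IsSphericalHarmonic n fun x => starRingEnd ℂ (f x) := by
  refine ⟨Complex.conjCLE.contDiff.contMDiff.comp hf.1, fun x => ?_⟩
  have h1 : radialExtension (fun x => starRingEnd ℂ (f x))
      = Complex.conjCLE ∘ radialExtension f := by
    funext y
    by_cases hy : y = 0 <;> simp [radialExtension, hy]
  rw [laplaceBeltrami, h1, InnerProductSpace.laplacian_CLE_comp_left]
  have h2 := congrArg (starRingEnd ℂ) (hf.2 x)
  simpa [laplaceBeltrami] using h2

lemma IsSphericalHarmonic.sub {n : ℕ} {f g : S2 → ℂ} (hf : IsSphericalHarmonic n f)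
    (hg : IsSphericalHarmonic n g) : IsSphericalHarmonic n fun x => f x - g x := by
  refine ⟨ContMDiff.sub hf.1 hg.1, fun x => ?_⟩
  have h1 : radialExtension (fun x => f x - g x) = radialExtension f - radialExtension g := by
    funext y
    by_cases hy : y = 0 <;> simp [radialExtension, hy]
  rw [laplaceBeltrami, h1, ContDiffAt.laplacian_sub
    (contDiffAt_infty.1 (hf.1.contDiffAt_radialExtension (coe_sphere_ne_zero x)) 2)
    (contDiffAt_infty.1 (hg.1.contDiffAt_radialExtension (coe_sphere_ne_zero x)) 2)]
  have h2 := hf.2 x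
  have h3 := hg.2 x
  simp only [laplaceBeltrami] at h2 h3
  linear_combination h2 - h3

lemma isSphericalHarmonic_zero (n : ℕ) : IsSphericalHarmonic n fun _ => 0 := by
  refine ⟨contMDiff_const, fun x => ?_⟩
  have h1 : radialExtension (fun _ => 0) = fun _ => 0 := by
    funext y
    by_cases hy : y = 0 <;> simp [radialExtension, hy]
  simp [laplaceBeltrami, h1]

/-- The spectral component of a continuous function is unique. -/
lemma IsSpectralComponent.unique {n : ℕ} {φ f g : S2 → ℂ} (hφ : Continuous φ)
    (hf : IsSpectralComponent n φ f) (hg : IsSpectralComponent n φ g) : f = g := by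
  have hfc := hf.1.1.continuous
  have hgc := hg.1.1.continuous
  -- Test both orthogonality relations against the difference `f - g` itself.
  have h1 := hf.2 _ (hf.1.sub hg.1)
  have h2 := hg.2 _ (hf.1.sub hg.1)
  have hc : Continuous fun x => starRingEnd ℂ (f x - g x) :=
    Complex.continuous_conj.comp (hfc.sub hgc)
  have h3 : ∫ x, ((‖f x - g x‖ ^ 2 : ℝ) : ℂ) ∂surfaceMeasure = 0 := by
    rw [← sub_self (0 : ℂ)]
    nth_rw 1 [← h2]
    rw [← h1, ← integral_sub
      (f := fun x => starRingEnd ℂ (f x - g x) * (φ x - g x))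
      (g := fun x => starRingEnd ℂ (f x - g x) * (φ x - f x))
      (integrable_surfaceMeasure (hc.mul (hφ.sub hgc)))
      (integrable_surfaceMeasure (hc.mul (hφ.sub hfc)))]
    congr 1
    funext x
    rw [Complex.ofReal_pow, ← Complex.conj_mul']
    ring
  rw [integral_complex_ofReal, Complex.ofReal_eq_zero] at h3
  have hn : Continuous fun x => ‖f x - g x‖ ^ 2 := (hfc.sub hgc).norm.pow 2
  rw [integral_eq_zero_iff_of_nonneg (fun x => by positivity) (integrable_surfaceMeasure hn)] at h3
  have h4 := (hn.ae_eq_iff_eq surfaceMeasure continuous_const).1 h3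
  funext x
  have h5 : ‖f x - g x‖ ^ 2 = 0 := congrFun h4 x
  simpa [sub_eq_zero] using h5

lemma IsSpectralComponent.spectralProj_eq {n : ℕ} {φ f : S2 → ℂ} (hφ : Continuous φ)
    (hf : IsSpectralComponent n φ f) : spectralProj n φ = f := by
  have hex : ∃ f, IsSpectralComponent n φ f := ⟨f, hf⟩
  rw [spectralProj, dif_pos hex]
  exact hex.choose_spec.unique hφ hf

/-- The sum of the beams with degrees in `[N, N + M)`. -/
noncomputable def packet (N M : ℕ) (x : S2) : ℂ := ∑ k ∈ Finset.Ico N (N + M), beam k x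

lemma isSmooth_packet (N M : ℕ) : IsSmooth (packet N M) := by
  have : packet N M = fun x : S2 =>
      (fun y : E3 => ∑ k ∈ Finset.Ico N (N + M), complexCoord y ^ k) (x : E3) := rfl
  rw [this]
  exact isSmooth_of_contDiff (ContDiff.sum fun k _ => contDiff_complexCoord.pow k)

lemma spectralProj_packet (N M n : ℕ) :
    spectralProj n (packet N M) = if n ∈ Finset.Ico N (N + M) then beam n else fun _ => 0 := by
  refine IsSpectralComponent.spectralProj_eq (isSmooth_packet N M).continuous ⟨?_, fun g hg => ?_⟩
  · split_ifs
    · exact isSphericalHarmonic_beam n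
    · exact isSphericalHarmonic_zero n
  · have h1 : ∀ x, packet N M x - (if n ∈ Finset.Ico N (N + M) then beam n else fun _ => 0) x
        = ∑ k ∈ (Finset.Ico N (N + M)).erase n, beam k x := by
      intro x
      split_ifs with h
      · rw [packet, ← Finset.add_sum_erase _ _ h, add_sub_cancel_left]
      · rw [Finset.erase_eq_of_notMem h, packet, sub_zero]
    simp only [h1, Finset.mul_sum]
    rw [integral_finsetSum]
    · exact Finset.sum_eq_zero fun k hk =>
        hg.conj.integral_mul_eq_zero (Finset.ne_of_mem_erase hk).symm (isSphericalHarmonic_beam k)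
    · intro k _
      exact integrable_surfaceMeasure
        (hg.conj.1.continuous.mul (isSmooth_beam k).continuous)

/-! ### The size of beams and of the equatorial strip -/

lemma complexCoord_normSq (y : E3) : ‖complexCoord y‖ ^ 2 = y 0 ^ 2 + y 1 ^ 2 := by
  rw [← Complex.normSq_eq_norm_sq, Complex.normSq_apply]
  simp [complexCoord]
  ring

lemma norm_sq_coords (y : E3) : ‖y‖ ^ 2 = y 0 ^ 2 + y 1 ^ 2 + y 2 ^ 2 := by
  rw [EuclideanSpace.real_norm_sq_eq, Fin.sum_univ_three]

lemma norm_complexCoord_sq (x : S2) : ‖complexCoord (x : E3)‖ ^ 2 = 1 - (x : E3) 2 ^ 2 := by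
  have h := norm_sq_coords (x : E3)
  rw [norm_eq_of_mem_sphere x] at h
  rw [complexCoord_normSq]
  linarith

lemma norm_complexCoord_le_one (x : S2) : ‖complexCoord (x : E3)‖ ≤ 1 := by
  have h := norm_complexCoord_sq x
  nlinarith [norm_nonneg (complexCoord (x : E3)), sq_nonneg ((x : E3) 2)]

lemma continuous_coord (i : Fin 3) : Continuous fun y : E3 => y i :=
  (EuclideanSpace.proj (𝕜 := ℝ) (ι := Fin 3) i).continuous

/-- The one-dimensional factors of the function `1_{|y₁| ≤ 1} 1_{|y₂| ≤ 1} exp (-n y₃²)`. -/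
noncomputable def slabFactor (n : ℕ) : Fin 3 → ℝ → ℝ :=
  ![(Set.Icc (-1) 1).indicator 1, (Set.Icc (-1) 1).indicator 1,
    fun t => Real.exp (-(n : ℝ) * t ^ 2)]

lemma integrable_prod_slabFactor {n : ℕ} (hn : 1 ≤ n) :
    Integrable fun y : E3 => ∏ i, slabFactor n i (y i) := by
  have hI : Integrable ((Set.Icc (-1 : ℝ) 1).indicator (1 : ℝ → ℝ)) :=
    (integrable_indicator_iff measurableSet_Icc).2 (by simp [integrableOn_const_iff, Pi.one_def])
  have h : Integrable fun z : Fin 3 → ℝ => ∏ i, slabFactor n i (z i) := by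
    refine Integrable.fintype_prod (μ := fun _ : Fin 3 => (volume : Measure ℝ))
      (f := slabFactor n) fun i => ?_
    fin_cases i
    · exact hI
    · exact hI
    · exact integrable_exp_neg_mul_sq (by exact_mod_cast hn)
  exact ((EuclideanSpace.volume_preserving_symm_measurableEquiv_toLp (Fin 3)).integrable_comp_emb
    (MeasurableEquiv.measurableEmbedding _)).2 h

lemma integral_prod_slabFactor (n : ℕ) :
    ∫ y : E3, ∏ i, slabFactor n i (y i) = 4 * Real.sqrt (Real.pi / n) := by
  have h := (EuclideanSpace.volume_preserving_symm_measurableEquiv_toLp (Fin 3)).integral_comp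
    (MeasurableEquiv.measurableEmbedding _) (fun z : Fin 3 → ℝ => ∏ i, slabFactor n i (z i))
  have h' : ∫ y : E3, ∏ i, slabFactor n i (y i)
      = ∫ z : Fin 3 → ℝ, ∏ i, slabFactor n i (z i) := h
  rw [h', integral_fintype_prod_volume_eq_prod, Fin.prod_univ_three]
  have hI : ∫ t, (Set.Icc (-1 : ℝ) 1).indicator (1 : ℝ → ℝ) t = 2 := by
    rw [integral_indicator_one measurableSet_Icc]
    simp
    norm_num
  simp only [slabFactor, Matrix.cons_val_zero, Matrix.cons_val_one, Matrix.cons_val]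
  rw [hI, integral_gaussian]
  ring

/-- The radial integral `∫₀¹ r² dr = 1 / 3`. -/
lemma integral_indicator_volumeIoiPow :
    ∫ r : Set.Ioi (0 : ℝ), (Set.Iio (1 : ℝ)).indicator (fun _ => (1 : ℂ)) r
      ∂Measure.volumeIoiPow (Module.finrank ℝ E3 - 1) = 1 / 3 := by
  have h1 : (fun r : Set.Ioi (0 : ℝ) => (Set.Iio (1 : ℝ)).indicator (fun _ => (1 : ℂ)) (r : ℝ))
      = (Set.Iio (⟨1, Set.mem_Ioi.2 one_pos⟩ : Set.Ioi (0 : ℝ))).indicator (fun _ => (1 : ℂ)) := by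
    funext r
    simp [Set.indicator, ← Subtype.coe_lt_coe]
  rw [h1, integral_indicator_const _ measurableSet_Iio, measureReal_def,
    Measure.volumeIoiPow_apply_Iio]
  simp
  norm_num

/-- The Gaussian majorant of a beam, integrated over the sphere. The cone over the sphere fills
the unit ball, and there `exp (-n y₃² / |y|²) ≤ exp (-n y₃²)`. -/
lemma integral_exp_neg_sq_le {n : ℕ} (hn : 1 ≤ n) :
    ∫ x : S2, Real.exp (-(n : ℝ) * (x : E3) 2 ^ 2) ∂surfaceMeasure
      ≤ 12 * Real.sqrt (Real.pi / n) := by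
  set F : S2 → ℝ := fun x => Real.exp (-(n : ℝ) * (x : E3) 2 ^ 2) with hF
  have hP := integral_radial_mul_radialExtension ((Set.Iio (1 : ℝ)).indicator fun _ => 1)
    (fun x => (F x : ℂ))
  rw [integral_indicator_volumeIoiPow, integral_complex_ofReal] at hP
  set G : E3 → ℝ := fun y => if ‖y‖ < 1 ∧ y ≠ 0 then
    Real.exp (-(n : ℝ) * (‖y‖⁻¹ * y 2) ^ 2) else 0 with hG
  have hGeq : (fun y : E3 => (Set.Iio (1 : ℝ)).indicator (fun _ => (1 : ℂ)) ‖y‖ *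
      radialExtension (fun x => (F x : ℂ)) y) = fun y => (G y : ℂ) := by
    funext y
    by_cases hy : y = 0
    · simp [hy, hG, radialExtension]
    · by_cases h1 : ‖y‖ < 1
      · simp [hy, hG, hF, h1, radialExtension]
      · simp [hG, h1]
  rw [hGeq, integral_complex_ofReal] at hP
  have hP' : ∫ y, G y = (∫ x, F x ∂surfaceMeasure) * (1 / 3) := by
    apply Complex.ofReal_injective
    push_cast
    exact hP
  have hle : ∫ y, G y ≤ ∫ y : E3, ∏ i, slabFactor n i (y i) := by
    refine integral_mono_of_nonneg (Filter.Eventually.of_forall fun y => ?_)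
      (integrable_prod_slabFactor hn) (Filter.Eventually.of_forall fun y => ?_)
    · simp only [hG, Pi.zero_apply]
      split_ifs <;> positivity
    · simp only [hG]
      split_ifs with h
      · have hsq := norm_sq_coords y
        have hpos : 0 < ‖y‖ := norm_pos_iff.2 h.2
        have hcoord : ∀ i, y i ∈ Set.Icc (-1 : ℝ) 1 := by
          intro i
          have := (PiLp.norm_apply_le y i).trans h.1.le
          rwa [Real.norm_eq_abs, abs_le] at this
        have h1 : 1 ≤ ‖y‖⁻¹ := (one_le_inv₀ hpos).2 h.1.le
        have h2 : y 2 ^ 2 ≤ (‖y‖⁻¹ * y 2) ^ 2 := by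
          rw [mul_pow]
          exact le_mul_of_one_le_left (sq_nonneg _) (one_le_pow₀ h1)
        simp only [Fin.prod_univ_three, slabFactor, Matrix.cons_val_zero, Matrix.cons_val_one,
          Matrix.cons_val, Set.indicator_of_mem (hcoord 0), Set.indicator_of_mem (hcoord 1),
          Pi.one_apply, one_mul]
        have hn0 : (0 : ℝ) ≤ n := n.cast_nonneg
        exact Real.exp_le_exp.2 (by nlinarith)
      · refine Finset.prod_nonneg fun i _ => ?_
        fin_cases i
        · exact Set.indicator_nonneg (fun _ _ => zero_le_one) _
        · exact Set.indicator_nonneg (fun _ _ => zero_le_one) _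
        · exact (Real.exp_pos _).le
  rw [hP', integral_prod_slabFactor] at hle
  linarith

/-- The square `|h_n|² = (1 - x₃²)ⁿ` is at most `exp (-n x₃²)`. -/
lemma eLpNorm_beam_sq_le {n : ℕ} (hn : 1 ≤ n) :
    eLpNorm (beam n) 2 surfaceMeasure ^ 2 ≤ ENNReal.ofReal (12 * Real.sqrt (Real.pi / n)) := by
  have h1 := eLpNorm_nnreal_pow_eq_lintegral (f := beam n) (μ := surfaceMeasure) (p := 2)
    two_ne_zero
  have h2 : eLpNorm (beam n) 2 surfaceMeasure ^ 2 = ∫⁻ x, ‖beam n x‖ₑ ^ 2 ∂surfaceMeasure := by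
    simpa using h1
  rw [h2]
  have hc : Continuous fun x : S2 => Real.exp (-(n : ℝ) * (x : E3) 2 ^ 2) :=
    Real.continuous_exp.comp (continuous_const.mul
      (((continuous_coord 2).comp continuous_subtype_val).pow 2))
  calc ∫⁻ x, ‖beam n x‖ₑ ^ 2 ∂surfaceMeasure
      ≤ ∫⁻ x : S2, ENNReal.ofReal (Real.exp (-(n : ℝ) * (x : E3) 2 ^ 2)) ∂surfaceMeasure := by
        refine lintegral_mono fun x => ?_
        rw [← ofReal_norm, ← ENNReal.ofReal_pow (norm_nonneg _)]
        refine ENNReal.ofReal_le_ofReal ?_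
        rw [beam, norm_pow, ← pow_mul, mul_comm n 2, pow_mul, norm_complexCoord_sq,
          show -(n : ℝ) * (x : E3) 2 ^ 2 = n * (-(x : E3) 2 ^ 2) by ring, Real.exp_nat_mul]
        refine pow_le_pow_left₀ ?_ ?_ n
        · rw [← norm_complexCoord_sq]
          positivity
        · linarith [Real.add_one_le_exp (-(x : E3) 2 ^ 2)]
    _ = ENNReal.ofReal (∫ x : S2, Real.exp (-(n : ℝ) * (x : E3) 2 ^ 2) ∂surfaceMeasure) := by
        rw [ofReal_integral_eq_lintegral_ofReal (integrable_surfaceMeasure hc)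
          (Filter.Eventually.of_forall fun x => (Real.exp_pos _).le)]
    _ ≤ _ := ENNReal.ofReal_le_ofReal (integral_exp_neg_sq_le hn)

/-- The equatorial strip `|x₃| ≤ δ`. -/
def strip (δ : ℝ) : Set S2 := {x | |(x : E3) 2| ≤ δ}

lemma measurableSet_strip (δ : ℝ) : MeasurableSet (strip δ) :=
  (isClosed_le (((continuous_coord 2).comp continuous_subtype_val).abs)
    continuous_const).measurableSet

open scoped Pointwise in
/-- The cone over the strip contains a box of volume `δ / 8`. -/
lemma le_surfaceMeasure_strip {δ : ℝ} (hδ : 0 ≤ δ) (hδ1 : δ ≤ 1 / 2) :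
    ENNReal.ofReal (δ / 8) ≤ surfaceMeasure (strip δ) := by
  set lo : Fin 3 → ℝ := ![1 / 2, -(1 / 4), -(δ / 2)] with hlo
  set hi : Fin 3 → ℝ := ![3 / 4, 1 / 4, δ / 2] with hhi
  set B : Set E3 := (fun y : E3 => (y.ofLp : Fin 3 → ℝ)) ⁻¹' Set.Icc lo hi with hB
  have hvol : volume B = ENNReal.ofReal (δ / 8) := by
    have h := (EuclideanSpace.volume_preserving_symm_measurableEquiv_toLp (Fin 3)).measure_preimage
      (measurableSet_Icc (a := lo) (b := hi)).nullMeasurableSet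
    have h' : volume B = volume (Set.Icc lo hi) := h
    rw [h', Real.volume_Icc_pi, Fin.prod_univ_three]
    simp only [hlo, hhi, Matrix.cons_val_zero, Matrix.cons_val_one, Matrix.cons_val]
    rw [← ENNReal.ofReal_mul (by norm_num), ← ENNReal.ofReal_mul (by norm_num)]
    congr 1
    ring
  have hsub : B ⊆ Set.Ioo (0 : ℝ) 1 • ((↑) '' strip δ : Set E3) := by
    intro y hy
    have h0 : 1 / 2 ≤ y 0 ∧ y 0 ≤ 3 / 4 := ⟨hy.1 0, hy.2 0⟩
    have h1 : -(1 / 4) ≤ y 1 ∧ y 1 ≤ 1 / 4 := ⟨hy.1 1, hy.2 1⟩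
    have h2 : -(δ / 2) ≤ y 2 ∧ y 2 ≤ δ / 2 := ⟨hy.1 2, hy.2 2⟩
    have hsq := norm_sq_coords y
    have hlow : 1 / 2 ≤ ‖y‖ := by
      refine (abs_le_of_sq_le_sq' ?_ (norm_nonneg y)).2
      nlinarith [sq_nonneg (y 1), sq_nonneg (y 2)]
    have hup : ‖y‖ < 1 := by
      refine (sq_lt_one_iff₀ (norm_nonneg y)).1 ?_
      nlinarith
    have hpos : 0 < ‖y‖ := by linarith
    have hm : ‖y‖⁻¹ • y ∈ Metric.sphere (0 : E3) 1 := by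
      rw [mem_sphere_zero_iff_norm, norm_smul, norm_inv, norm_norm, inv_mul_cancel₀ hpos.ne']
    refine Set.mem_smul.2 ⟨‖y‖, ⟨hpos, hup⟩, ‖y‖⁻¹ • y, ⟨⟨_, hm⟩, ?_, rfl⟩, ?_⟩
    · change |‖y‖⁻¹ * y 2| ≤ δ
      rw [abs_mul, abs_of_pos (inv_pos.2 hpos), inv_mul_le_iff₀ hpos]
      have : |y 2| ≤ δ / 2 := abs_le.2 h2
      nlinarith
    · rw [smul_smul, mul_inv_cancel₀ hpos.ne', one_smul]
  rw [surfaceMeasure, Measure.toSphere_apply' _ (measurableSet_strip δ), ← hvol]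
  calc volume B ≤ volume (Set.Ioo (0 : ℝ) 1 • ((↑) '' strip δ : Set E3)) := measure_mono hsub
    _ ≤ _ := le_mul_of_one_le_left zero_le (by simp)

/-! ### The maximal function of a packet of beams -/

lemma schrodingerFlow_packet (t : ℝ) (N M : ℕ) (x : S2) :
    schrodingerFlow t (packet N M) x
      = ∑ n ∈ Finset.Ico N (N + M),
        Complex.exp (-Complex.I * (t : ℂ) * ((n : ℂ) * ((n : ℂ) + 1))) * beam n x := by
  rw [schrodingerFlow, tsum_eq_sum (s := Finset.Ico N (N + M))]
  · refine Finset.sum_congr rfl fun n hn => ?_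
    rw [spectralProj_packet, if_pos hn]
  · intro n hn
    rw [spectralProj_packet, if_neg hn, mul_zero]

/-- At a point of longitude `θ` the packet refocuses at time `t = θ / (2 N + 1)`: the phases
`n θ - t n (n + 1)` are then, up to a common constant, `-t (n - N)²`, which is small. -/
lemma le_maximalFunction_packet {N M : ℕ} (hNM : 6 * M ^ 2 ≤ 2 * N + 1) (x : S2) :
    ENNReal.ofReal (M / 2 * ‖complexCoord (x : E3)‖ ^ (N + M)) ≤
      maximalFunction (packet N M) x := by
  set z := complexCoord (x : E3)
  obtain ⟨θ, hθ0, hθ1, hθ⟩ : ∃ θ : ℝ, 0 ≤ θ ∧ θ ≤ 2 * Real.pi ∧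
      z = ‖z‖ * Complex.exp (θ * Complex.I) := by
    rcases le_or_gt 0 z.arg with h | h
    · exact ⟨z.arg, h, by linarith [Complex.arg_le_pi z, Real.pi_pos],
        (Complex.norm_mul_exp_arg_mul_I z).symm⟩
    · refine ⟨z.arg + 2 * Real.pi, by linarith [Complex.neg_pi_lt_arg z, Real.pi_pos],
        by linarith, ?_⟩
      have := Complex.exp_periodic (z.arg * Complex.I)
      push_cast
      rw [add_mul, this, Complex.norm_mul_exp_arg_mul_I]
  have hN : (0 : ℝ) < 2 * N + 1 := by positivity
  set t : ℝ := θ / (2 * N + 1) with ht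
  have htN : t * (2 * N + 1) = θ := div_mul_cancel₀ _ hN.ne'
  have ht0 : 0 ≤ t := div_nonneg hθ0 hN.le
  have ht1 : t ≤ 2 * Real.pi := by
    refine (div_le_self hθ0 ?_).trans hθ1
    linarith [(N.cast_nonneg : (0 : ℝ) ≤ N)]
  refine le_trans ?_ (le_iSup₂ (f := fun t _ => ‖schrodingerFlow t (packet N M) x‖ₑ) t ⟨ht0, ht1⟩)
  rw [← ofReal_norm]
  refine ENNReal.ofReal_le_ofReal ?_
  set α : ℝ := N * θ - t * (N ^ 2 + N)
  have hterm : ∀ n ∈ Finset.Ico N (N + M),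
      Complex.exp (-Complex.I * (t : ℂ) * ((n : ℂ) * ((n : ℂ) + 1))) * beam n x
        = Complex.exp (α * Complex.I) *
          ((‖z‖ ^ n : ℝ) * Complex.exp ((-(t * ((n : ℝ) - N) ^ 2) : ℝ) * Complex.I)) := by
    intro n _
    have hb : beam n x = z ^ n := rfl
    rw [hb, hθ, mul_pow, ← Complex.exp_nat_mul, norm_mul, Complex.norm_exp_ofReal_mul_I, mul_one,
      Complex.norm_real, norm_norm, Complex.ofReal_pow]
    have : -Complex.I * (t : ℂ) * ((n : ℂ) * ((n : ℂ) + 1)) + n * (θ * Complex.I)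
        = α * Complex.I + (-(t * ((n : ℝ) - N) ^ 2) : ℝ) * Complex.I := by
      simp only [α, ← htN]
      push_cast
      ring
    calc _ = (‖z‖ : ℂ) ^ n * (Complex.exp (-Complex.I * (t : ℂ) * ((n : ℂ) * ((n : ℂ) + 1))) *
          Complex.exp (n * (θ * Complex.I))) := by ring
      _ = _ := by
        rw [← Complex.exp_add, this, Complex.exp_add]
        ring
  rw [schrodingerFlow_packet, Finset.sum_congr rfl hterm, ← Finset.mul_sum, norm_mul,
    Complex.norm_exp_ofReal_mul_I, one_mul]
  refine le_trans ?_ (Complex.re_le_norm _)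
  rw [Complex.re_sum]
  have hcard : (M : ℝ) / 2 * ‖z‖ ^ (N + M)
      = ∑ _n ∈ Finset.Ico N (N + M), ‖z‖ ^ (N + M) * (1 / 2) := by
    simp
    ring
  rw [hcard]
  refine Finset.sum_le_sum fun n hn => ?_
  rw [Finset.mem_Ico] at hn
  rw [Complex.re_ofReal_mul, Complex.exp_ofReal_mul_I_re, Real.cos_neg]
  have hz := norm_complexCoord_le_one x
  refine mul_le_mul (pow_le_pow_of_le_one (norm_nonneg _) hz hn.2.le) ?_ (by norm_num)
    (by positivity)
  have hd0 : (0 : ℝ) ≤ (n : ℝ) - N := by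
    rw [sub_nonneg]; exact_mod_cast hn.1
  have hd1 : (n : ℝ) - N ≤ M := by
    rw [sub_le_iff_le_add']; exact_mod_cast hn.2.le
  have hNM' : (6 : ℝ) * M ^ 2 ≤ 2 * N + 1 := by exact_mod_cast hNM
  have hsmall : t * ((n : ℝ) - N) ^ 2 ≤ Real.pi / 3 := by
    have h1 : ((n : ℝ) - N) ^ 2 ≤ (2 * N + 1) / 6 := by nlinarith
    calc t * ((n : ℝ) - N) ^ 2 ≤ t * ((2 * N + 1) / 6) := by gcongr
      _ = θ / 6 := by rw [← htN]; ring
      _ ≤ Real.pi / 3 := by linarith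
  rw [← Real.cos_pi_div_three]
  exact Real.cos_le_cos_of_nonneg_of_le_pi (by positivity) (by linarith [Real.pi_pos]) hsmall

/-- Lower bound for the `L^p` norm of the maximal function, from the strip of width `1 / (2 M)`
on which all beams of degree at most `4 M²` have size comparable to `1`.
For `p = ∞` the exponent `1 / p.toReal` is `0`, as it should be. -/
lemma le_eLpNorm_maximalFunction_packet {M : ℕ} (hM : 1 ≤ M) {p : ℝ≥0∞} (hp : p ≠ 0) :
    ENNReal.ofReal (M / 4 * (1 / (16 * M)) ^ (1 / p.toReal)) ≤
      eLpNorm (maximalFunction (packet (3 * M ^ 2) M)) p surfaceMeasure := by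
  have hM1 : (1 : ℝ) ≤ M := by exact_mod_cast hM
  have hM0 : (0 : ℝ) < M := by linarith
  set δ : ℝ := 1 / (2 * M) with hδ
  have hδ0 : 0 < δ := by positivity
  have hδM : δ * (2 * M) = 1 := by rw [hδ]; field_simp
  have hδ1 : δ ≤ 1 / 2 := by nlinarith
  have hvol := le_surfaceMeasure_strip hδ0.le hδ1
  have hvol0 : surfaceMeasure (strip δ) ≠ 0 := by
    refine (lt_of_lt_of_le ?_ hvol).ne'
    simpa using hδ0
  have hpt : ∀ x, ‖(strip δ).indicator (fun _ => ((M : ℝ) / 4)) x‖ₑ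
      ≤ ‖maximalFunction (packet (3 * M ^ 2) M) x‖ₑ := by
    intro x
    by_cases hx : x ∈ strip δ
    · rw [Set.indicator_of_mem hx, enorm_eq_self]
      refine le_trans ?_ (le_maximalFunction_packet (by lia) x)
      rw [← ofReal_norm, Real.norm_of_nonneg (by positivity)]
      refine ENNReal.ofReal_le_ofReal ?_
      have hx2 : (x : E3) 2 ^ 2 ≤ δ ^ 2 := sq_le_sq' (abs_le.1 hx).1 (abs_le.1 hx).2
      have hsq := norm_complexCoord_sq x
      have hpow : (1 : ℝ) / 2 ≤ ‖complexCoord (x : E3)‖ ^ (3 * M ^ 2 + M) := by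
        calc (1 : ℝ) / 2 = 1 + ((2 * M ^ 2 : ℕ) : ℝ) * (-δ ^ 2) := by
              push_cast
              linear_combination (1 / 2 + δ * M) * hδM
          _ ≤ (1 + -δ ^ 2) ^ (2 * M ^ 2) := one_add_mul_le_pow (by nlinarith) _
          _ ≤ (‖complexCoord (x : E3)‖ ^ 2) ^ (2 * M ^ 2) := by
              refine pow_le_pow_left₀ (by nlinarith) ?_ _
              rw [hsq]
              linarith
          _ = ‖complexCoord (x : E3)‖ ^ (4 * M ^ 2) := by
              rw [← pow_mul]
              congr 1
              ring
          _ ≤ _ := pow_le_pow_of_le_one (norm_nonneg _) (norm_complexCoord_le_one x) (by nlinarith)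
      nlinarith
    · simp [Set.indicator_of_notMem hx]
  refine le_trans ?_ (eLpNorm_mono_enorm hpt)
  rw [eLpNorm_indicator_const' (measurableSet_strip δ) hvol0 hp, ← ofReal_norm,
    Real.norm_of_nonneg (by positivity), ENNReal.ofReal_mul (by positivity)]
  gcongr
  rw [← ENNReal.ofReal_rpow_of_nonneg (by positivity) (by positivity)]
  gcongr
  refine le_trans (le_of_eq ?_) hvol
  congr 1
  rw [hδ]
  field_simp
  norm_num

/-- Upper bound for the Sobolev norm of a packet: each of the `M` beams has squared `L²` norm
`O (1 / M)` and `1 + n (n + 1) ≤ (5 M²)²` for its degree `n`. -/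
lemma sobolevNorm_packet_le {M : ℕ} (hM : 1 ≤ M) {s r : ℝ} (hsr : s ≤ r) (hr : 0 ≤ r) :
    sobolevNorm s (packet (3 * M ^ 2) M) ≤
      ENNReal.ofReal (Real.sqrt (24 * 25 ^ r) * (M : ℝ) ^ (2 * r)) := by
  have hM1 : (1 : ℝ) ≤ M := by exact_mod_cast hM
  have hM0 : (0 : ℝ) < M := by linarith
  have hterm : ∀ n : ℕ, n ∈ Finset.Ico (3 * M ^ 2) (3 * M ^ 2 + M) →
      ENNReal.ofReal ((1 + (n : ℝ) * ((n : ℝ) + 1)) ^ s) *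
        eLpNorm (spectralProj n (packet (3 * M ^ 2) M)) 2 surfaceMeasure ^ 2
      ≤ ENNReal.ofReal ((25 * (M : ℝ) ^ 4) ^ r * (24 / M)) := by
    intro n hn
    rw [spectralProj_packet, if_pos hn, ENNReal.ofReal_mul (by positivity)]
    rw [Finset.mem_Ico] at hn
    have hn1 : (3 : ℝ) * M ^ 2 ≤ n := by exact_mod_cast hn.1
    have hn2 : (n : ℝ) ≤ 3 * M ^ 2 + M := by exact_mod_cast hn.2.le
    refine mul_le_mul' (ENNReal.ofReal_le_ofReal ?_)
      ((eLpNorm_beam_sq_le (by nlinarith)).trans (ENNReal.ofReal_le_ofReal ?_))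
    · have h1 : (1 : ℝ) ≤ 1 + (n : ℝ) * ((n : ℝ) + 1) := by
        have : (0 : ℝ) ≤ n := n.cast_nonneg
        nlinarith
      refine (Real.rpow_le_rpow_of_exponent_le h1 hsr).trans
        (Real.rpow_le_rpow (by linarith) ?_ hr)
      have h2 : (n : ℝ) ≤ 4 * M ^ 2 := by nlinarith
      have h3 : (1 : ℝ) ≤ (M : ℝ) ^ 2 := one_le_pow₀ hM1
      have h4 : (n : ℝ) * (n + 1) ≤ 4 * M ^ 2 * (4 * M ^ 2 + 1) :=
        mul_le_mul h2 (by linarith) (by positivity) (by positivity)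
      nlinarith
    · have hn0 : (0 : ℝ) < n := lt_of_lt_of_le (by positivity) hn1
      have : Real.sqrt (Real.pi / n) ≤ 2 / M := by
        refine Real.sqrt_le_iff.2 ⟨by positivity, ?_⟩
        rw [div_pow, div_le_div_iff₀ hn0 (by positivity)]
        nlinarith [Real.pi_lt_four, Real.pi_pos, sq_nonneg (M : ℝ)]
      calc 12 * Real.sqrt (Real.pi / n) ≤ 12 * (2 / M) := by gcongr
        _ = 24 / M := by ring
  have hsum : ∑' n : ℕ, ENNReal.ofReal ((1 + (n : ℝ) * ((n : ℝ) + 1)) ^ s) *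
        eLpNorm (spectralProj n (packet (3 * M ^ 2) M)) 2 surfaceMeasure ^ 2
      ≤ ENNReal.ofReal (24 * 25 ^ r * (M : ℝ) ^ (4 * r)) := by
    rw [tsum_eq_sum (s := Finset.Ico (3 * M ^ 2) (3 * M ^ 2 + M))]
    · refine (Finset.sum_le_sum hterm).trans (le_of_eq ?_)
      rw [Finset.sum_const, Nat.card_Ico, add_tsub_cancel_left, nsmul_eq_mul,
        ← ENNReal.ofReal_natCast, ← ENNReal.ofReal_mul (by positivity)]
      congr 1
      rw [Real.mul_rpow (by norm_num) (by positivity), ← Real.rpow_natCast, ← Real.rpow_mul hM0.le]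
      push_cast
      field_simp
    · intro n hn
      rw [spectralProj_packet, if_neg hn]
      have : eLpNorm (fun _ : S2 => (0 : ℂ)) 2 surfaceMeasure = 0 := eLpNorm_zero'
      rw [this]
      simp
  rw [sobolevNorm]
  refine (ENNReal.rpow_le_rpow hsum (by norm_num)).trans (le_of_eq ?_)
  rw [ENNReal.ofReal_rpow_of_nonneg (by positivity) (by norm_num)]
  congr 1
  rw [Real.mul_rpow (by positivity) (by positivity), ← Real.rpow_mul hM0.le, Real.sqrt_eq_rpow]
  congr 2
  ring

theorem theorem1p1 (p : ℝ≥0∞) (hp : 2 ≤ p) (s : ℝ) (hs : s < 1 / 2 - (1 / (2 * p)).toReal) :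
    ¬ ∃ C : NNReal, ∀ φ : S2 → ℂ, IsSmooth φ →
      eLpNorm (maximalFunction φ) p surfaceMeasure ≤ (C : ℝ≥0∞) * sobolevNorm s φ := by
  rintro ⟨C, hC⟩
  set P : ℝ := 1 / p.toReal with hP
  have hPhalf : (1 / (2 * p)).toReal = P / 2 := by
    rw [ENNReal.toReal_div, ENNReal.toReal_mul, hP]
    simp
    ring
  have hp0 : p ≠ 0 := by
    rintro rfl
    simp at hp
  have hP1 : P ≤ 1 / 2 := by
    by_cases htop : p = ⊤
    · simp [hP, htop]
    · have : 2 ≤ p.toReal := by simpa using (ENNReal.toReal_le_toReal (by simp) htop).2 hp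
      rw [hP]
      exact one_div_le_one_div_of_le two_pos this
  rw [hPhalf] at hs
  set r : ℝ := max s 0
  -- Raising `s` to `max s 0` keeps it below the threshold, since the latter is at least `1 / 4`.
  have hr : 0 < 1 - P - 2 * r := by
    have : r < 1 / 2 - P / 2 := max_lt hs (by linarith)
    linarith
  set K : ℝ := Real.sqrt (24 * 25 ^ r)
  have hbound : ∀ M : ℕ, 1 ≤ M → (M : ℝ) ^ (1 - P - 2 * r) ≤ 4 * 16 ^ P * C * K := by
    intro M hM
    have hM0 : (0 : ℝ) < M := by exact_mod_cast hM
    have h1 := (le_eLpNorm_maximalFunction_packet hM hp0).trans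
      ((hC _ (isSmooth_packet (3 * M ^ 2) M)).trans
        (mul_le_mul_right (sobolevNorm_packet_le hM (le_max_left s 0) (le_max_right s 0)) _))
    rw [← ENNReal.ofReal_coe_nnreal, ← ENNReal.ofReal_mul C.coe_nonneg,
      ENNReal.ofReal_le_ofReal_iff (by positivity), ← hP] at h1
    rw [one_div, Real.inv_rpow (by positivity), Real.mul_rpow (by norm_num) hM0.le] at h1
    rw [Real.rpow_sub hM0, Real.rpow_sub hM0, Real.rpow_one, div_div,
      div_le_iff₀ (by positivity)]
    have h2 : (M : ℝ) = 4 * 16 ^ P * (M : ℝ) ^ P * (M / 4 * (16 ^ P * (M : ℝ) ^ P)⁻¹) := by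
      field_simp
    calc (M : ℝ) = 4 * 16 ^ P * (M : ℝ) ^ P * (M / 4 * (16 ^ P * (M : ℝ) ^ P)⁻¹) := h2
      _ ≤ 4 * 16 ^ P * (M : ℝ) ^ P * (C * (K * (M : ℝ) ^ (2 * r))) := by gcongr
      _ = _ := by ring
  have hlim : Filter.Tendsto (fun M : ℕ => (M : ℝ) ^ (1 - P - 2 * r)) Filter.atTop Filter.atTop :=
    (tendsto_rpow_atTop hr).comp tendsto_natCast_atTop_atTop
  obtain ⟨M, hM1, hM2⟩ := ((Filter.eventually_ge_atTop 1).and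
    (hlim.eventually_gt_atTop (4 * 16 ^ P * C * K))).exists
  exact absurd (hbound M hM1) (not_le.2 hM2)
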